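/- Let $A\in\mathbb{R}^{p\times n}$, $B\in\mathbb{R}^{p\times m}$, $b\in\mathbb{R}^p$, $c,h\in\mathbb{R}^m$, $g\in\mathbb{R}^n$, and assume that the polyhedron $D:=\{(x,y)\in\mathbb{R}^n\times\mathbb{R}^m : Ax+By\le b\}$ is nonempty and bounded. Let $X:=\{x\in\mathbb{R}^n : \exists y\in\mathbb{R}^m,\ (x,y)\in D\}$, and for $x\in X$ let $$S(x):=\operatorname*{argmin}_{y}\{c^\top y : Ax+By\le b\}.$$ Let $\iota$ be the neutral belief over $S$, that is, $\iota_x$ is the uniform distribution on $S(x)$, $$\iota_x(E):=\frac{\lambda_x(E\cap S(x))}{\lambda_x(S(x))}\qquad (E\subseteq\mathbb{R}^m \text{ Borel}),$$ where $\lambda_x$ is the Lebesgue measure on the affine space generated by $S(x)$ (the counting measure if $S(x)$ is a single point). Then, for every $x\in X$, $\iota_x$ is a well-defined Borel probability measure with $\iota_x(S(x))=1$ and $y\mapsto h^\top y$ is $\iota_x$-integrable; and the objective function of the leader in the fully linear bilevel problem under the Bayesian approach, $$x\mapsto g^\top x+\mathbb{E}_{\iota_x}[h^\top y],$$ is Lipschitz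 on its domain $X$ (with respect to the Euclidean norm): there is $L\ge 0$ with $\big|(g^\top x+\mathbb{E}_{\iota_x}[h^\top y])-(g^\top x'+\mathbb{E}_{\iota_{x'}}[h^\top y])\big|\le L\|x-x'\|$ for all $x,x'\in X$. -/

import Mathlib

noncomputable section

namespace LinearBilevel

open MeasureTheory
open scoped Matrix

/-- Lebesgue measure of the affine space generated by `K`, seen as a measure on the ambient
Euclidean space: the `k`-dimensional Hausdorff measure, normalized so as to agree with Lebesgue
measure on `k`-dimensional Euclidean spaces (counting measure if `k = 0`), restricted to the affine
hull of `K`, where `k` is the dimension of that hull. -/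
def lebesgueOnSpan {m : ℕ} (K : Set (EuclideanSpace ℝ (Fin m))) :
    Measure (EuclideanSpace ℝ (Fin m)) :=
  (Measure.euclideanHausdorffMeasure (Module.finrank ℝ (affineSpan ℝ K).direction)).restrict
    (affineSpan ℝ K : Set (EuclideanSpace ℝ (Fin m)))

/-- The uniform distribution over `K`: it gives to a measurable set `A` the mass
`λ (A ∩ K) / λ K`, with `λ` the Lebesgue measure of the affine space generated by `K`. -/
def uniformLaw {m : ℕ} (K : Set (EuclideanSpace ℝ (Fin m))) :
    Measure (EuclideanSpace ℝ (Fin m)) :=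
  ProbabilityTheory.cond (lebesgueOnSpan K) K

/-- The neutral belief over a set-valued map `S`. -/
def neutralBelief {X : Type*} {m : ℕ} (S : X → Set (EuclideanSpace ℝ (Fin m))) (x : X) :
    Measure (EuclideanSpace ℝ (Fin m)) :=
  uniformLaw (S x)

variable {n m p : ℕ} (A : Matrix (Fin p) (Fin n) ℝ) (B : Matrix (Fin p) (Fin m) ℝ)
  (b : Fin p → ℝ) (c : Fin m → ℝ)

/-- The polyhedron of all `(x, y)` with `A x + B y ≤ b` (componentwise). -/
def jointFeasible : Set (EuclideanSpace ℝ (Fin n) × EuclideanSpace ℝ (Fin m)) :=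
  {z | A *ᵥ z.1.ofLp + B *ᵥ z.2.ofLp ≤ b}

/-- The leader's feasible set: all `x` for which some `y` satisfies `A x + B y ≤ b`. -/
def leaderFeasible : Set (EuclideanSpace ℝ (Fin n)) :=
  {x | ∃ y : EuclideanSpace ℝ (Fin m), (x, y) ∈ jointFeasible A B b}

/-- The follower's solution set `argmin_y {cᵀ y : A x + B y ≤ b}`. -/
def followerArgmin (x : EuclideanSpace ℝ (Fin n)) : Set (EuclideanSpace ℝ (Fin m)) :=
  {y | (x, y) ∈ jointFeasible A B b ∧
    ∀ z : EuclideanSpace ℝ (Fin m), (x, z) ∈ jointFeasible A B b → c ⬝ᵥ y.ofLp ≤ c ⬝ᵥ z.ofLp}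

/-- The leader's objective `x ↦ gᵀ x + E_{β x}[hᵀ y]` for a belief `β`. -/
def leaderObjective (g : Fin n → ℝ) (h : Fin m → ℝ)
    (β : EuclideanSpace ℝ (Fin n) → Measure (EuclideanSpace ℝ (Fin m)))
    (x : EuclideanSpace ℝ (Fin n)) : ℝ :=
  g ⬝ᵥ x.ofLp + ∫ y, h ⬝ᵥ y.ofLp ∂(β x)

end LinearBilevel

end

open MeasureTheory ProbabilityTheory Set Module
open scoped Pointwise

namespace LinearBilevel

/-! ### Uniform laws in linear coordinates -/

section Parametrization

variable {m : ℕ} {F : Type*} [NormedAddCommGroup F] [NormedSpace ℝ F]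
  (f : F →ₗ[ℝ] EuclideanSpace ℝ (Fin m)) (p : EuclideanSpace ℝ (Fin m))

/-! For feasible `x` the solution set `S(x)` is a polytope with fixed rows: those of `B`, a box
containing the bounded set `D`, and the row `c` with the optimal value as its bound. Only the
right-hand side depends on `x`. It therefore suffices that the mean of a linear form over a nonempty
polytope is Lipschitz in the right-hand side, and that the optimal value is Lipschitz in `x`. Both
follow from `exists_lipschitz_polytope`, by induction on dimension.

Lowering one bound cuts a body `K` by a half-space `l ≤ T`. The sections `l = t` are translates of
polytopes of smaller dimension whose right-hand side is affine in `t`, so by induction the mean over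
a section is a Lipschitz function `ψ` of `t`. By Fubini (`integral_uniformLaw_eq_of_sections`) the
mean over `K` is the mean of `ψ ∘ l`. If `l` ranges in `[a, b]` on `K`, `k` is the dimension of `K`
and `θ = (T - a) / (b - a)`, then the homothety of ratio `θ` at a minimizer of `l` maps `K` into the
part kept. The fraction lost is at most `1 - θ ^ k ≤ k (1 - θ)`, while `ψ ∘ l` oscillates by at most
`L (b - a)`. The product is at most `k L (b - T)`: the width `b - a` cancels, so thin bodies and
drops of dimension do no harm (`abs_integral_comp_uniformLaw_sub_le`).

For the optimal value, the cutting estimate is `abs_sInf_image_sub_le`. -/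

theorem isClosedEmbedding_const_add_linearMap [FiniteDimensional ℝ F] (hf : Function.Injective f) :
    Topology.IsClosedEmbedding fun w => p + f w :=
  (Homeomorph.addLeft p).isClosedEmbedding.comp
    (LinearMap.isClosedEmbedding_of_injective (LinearMap.ker_eq_bot.2 hf))

/-- The affine map `w ↦ p + f w`. -/
noncomputable def affineOf : F →ᵃ[ℝ] EuclideanSpace ℝ (Fin m) :=
  (AffineEquiv.constVAdd ℝ (EuclideanSpace ℝ (Fin m)) p).toAffineMap.comp f.toAffineMap

theorem coe_affineOf : (affineOf f p : F → EuclideanSpace ℝ (Fin m)) = fun w => p + f w := rfl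

theorem linear_affineOf : (affineOf f p).linear = f := by
  ext w; simp [affineOf]

variable [FiniteDimensional ℝ F] [MeasurableSpace F] [BorelSpace F]
  (ν : Measure F) [ν.IsAddHaarMeasure]

/-- Uniqueness of Haar measure on the range of `f`, carried to the affine subspace by the isometry
`j`. The unknown factor disappears once laws are normalized, so any Haar measure in any linear
coordinates computes `uniformLaw`. -/
theorem exists_restrict_range_eq_smul_map (hf : Function.Injective f) :
    ∃ c : NNReal, c ≠ 0 ∧
      (Measure.euclideanHausdorffMeasure (finrank ℝ F)).restrict (range fun w => p + f w) =
        c • ν.map fun w => p + f w := by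
  let W := LinearMap.range f
  let e : F ≃L[ℝ] W := (LinearEquiv.ofInjective f hf).toContinuousLinearEquiv
  let j : W → EuclideanSpace ℝ (Fin m) := fun w => p + (w : EuclideanSpace ℝ (Fin m))
  have hj : Isometry j := (IsometryEquiv.addLeft p).isometry.comp isometry_subtype_coe
  have hje : (fun w => p + f w) = j ∘ e := rfl
  have hr : finrank ℝ F = finrank ℝ W := e.toLinearEquiv.finrank_eq
  have hrange : (range fun w => p + f w) = range j := by
    rw [hje, range_comp, e.surjective.range_eq, image_univ]
  obtain ⟨c, hc0, hH⟩ : ∃ c : NNReal, c ≠ 0 ∧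
      (Measure.euclideanHausdorffMeasure (finrank ℝ W) : Measure W) = c • ν.map e := ⟨_,
    (Measure.addHaarScalarFactor_pos_of_isAddHaarMeasure _ (ν.map e)).ne',
    Measure.isAddLeftInvariant_eq_smul
    (Measure.euclideanHausdorffMeasure (finrank ℝ W) : Measure W) (ν.map e)⟩
  refine ⟨c, hc0, ?_⟩
  rw [hrange, ← hj.map_euclideanHausdorffMeasure, hr, hH, hje,
    ← Measure.map_map hj.continuous.measurable e.continuous.measurable, Measure.map_smul]

theorem uniformLaw_image (hf : Function.Injective f) {K : Set F} (hK : IsCompact K)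
    (hc : affineSpan ℝ K = ⊤) :
    uniformLaw ((fun w => p + f w) '' K) = (cond ν K).map fun w => p + f w := by
  obtain ⟨c, hc0, hcν⟩ := exists_restrict_range_eq_smul_map f p ν hf
  have hemb := (isClosedEmbedding_const_add_linearMap f p hf).measurableEmbedding
  have hspan : affineSpan ℝ ((fun w => p + f w) '' K) = (⊤ : AffineSubspace ℝ F).map (affineOf f p) := by
    rw [← hc, AffineSubspace.map_span, coe_affineOf]
  have hdir : finrank ℝ (affineSpan ℝ ((fun w => p + f w) '' K)).direction = finrank ℝ F := by
    rw [hspan, AffineSubspace.map_direction, linear_affineOf, AffineSubspace.direction_top,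
      Submodule.map_top, LinearMap.finrank_range_of_inj hf]
  have hcoe : (affineSpan ℝ ((fun w => p + f w) '' K) : Set (EuclideanSpace ℝ (Fin m))) =
      range fun w => p + f w := by
    rw [hspan, AffineSubspace.coe_map, AffineSubspace.top_coe, image_univ, coe_affineOf]
  have hleb : lebesgueOnSpan ((fun w => p + f w) '' K) = c • ν.map fun w => p + f w := by
    rw [lebesgueOnSpan, hdir, hcoe, hcν]
  have hpre : (fun w => p + f w) ⁻¹' ((fun w => p + f w) '' K) = K :=
    preimage_image_eq _ (isClosedEmbedding_const_add_linearMap f p hf).injective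
  have hmeas : MeasurableSet ((fun w => p + f w) '' K) :=
    hemb.measurableSet_image.2 hK.measurableSet
  ext s hs
  rw [uniformLaw, hleb, hemb.map_apply, cond_apply hmeas, cond_apply hK.measurableSet]
  simp only [Measure.smul_apply, hemb.map_apply, hpre, preimage_inter, ENNReal.smul_def, smul_eq_mul]
  rw [ENNReal.mul_inv (by simp [hc0]) (by simp)]
  rw [mul_mul_mul_comm, ENNReal.inv_mul_cancel (by simpa using hc0) (by simp), one_mul]

end Parametrization

section Preimage

variable {m : ℕ} {F : Type*} [NormedAddCommGroup F] [NormedSpace ℝ F]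
  {f : F →ₗ[ℝ] EuclideanSpace ℝ (Fin m)} {p : EuclideanSpace ℝ (Fin m)}
  {K : Set (EuclideanSpace ℝ (Fin m))}

theorem isCompact_preimage_const_add [FiniteDimensional ℝ F] (hf : Function.Injective f) (hK : IsCompact K) :
    IsCompact ((fun w => p + f w) ⁻¹' K) :=
  (isClosedEmbedding_const_add_linearMap f p hf).isCompact_preimage hK

theorem convex_preimage_const_add (hK : Convex ℝ K) : Convex ℝ ((fun w => p + f w) ⁻¹' K) :=
  hK.affine_preimage (affineOf f p)

theorem affineSpan_preimage_const_add (hf : Function.Injective f)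
    (hr : (affineSpan ℝ K : Set (EuclideanSpace ℝ (Fin m))) = range fun w => p + f w) :
    affineSpan ℝ ((fun w => p + f w) ⁻¹' K) = ⊤ := by
  have hinj : Function.Injective (affineOf f p) := fun x y h => hf (add_left_cancel h)
  have himg : (affineOf f p) '' ((fun w => p + f w) ⁻¹' K) = K := by
    rw [coe_affineOf, image_preimage_eq_iff, ← hr]
    exact subset_affineSpan ℝ K
  apply AffineSubspace.coe_injective
  apply hinj.image_injective
  rw [← AffineSubspace.coe_map, AffineSubspace.map_span, himg, hr]
  simp [coe_affineOf]

variable [FiniteDimensional ℝ F] [MeasurableSpace F]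
  (ν : Measure F) [ν.IsAddHaarMeasure]

/-- A convex set that affinely spans a finite-dimensional space has interior points. -/
theorem measure_preimage_pos (hf : Function.Injective f) (hc : Convex ℝ K)
    (hr : (affineSpan ℝ K : Set (EuclideanSpace ℝ (Fin m))) = range fun w => p + f w) :
    0 < ν ((fun w => p + f w) ⁻¹' K) :=
  Measure.measure_pos_of_nonempty_interior _
    ((convex_preimage_const_add hc).interior_nonempty_iff_affineSpan_eq_top.2
      (affineSpan_preimage_const_add hf hr))

variable [BorelSpace F]

theorem uniformLaw_eq_map (hf : Function.Injective f) (hK : IsCompact K)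
    (hr : (affineSpan ℝ K : Set (EuclideanSpace ℝ (Fin m))) = range fun w => p + f w) :
    uniformLaw K = (cond ν ((fun w => p + f w) ⁻¹' K)).map fun w => p + f w := by
  have himg : (fun w => p + f w) '' ((fun w => p + f w) ⁻¹' K) = K := by
    rw [image_preimage_eq_iff, ← hr]
    exact subset_affineSpan ℝ K
  rw [← uniformLaw_image f p ν hf (isCompact_preimage_const_add hf hK)
    (affineSpan_preimage_const_add hf hr), himg]

/-- The mean of `φ` under the uniform law in a parametrization of the affine hull. -/
theorem integral_uniformLaw (hf : Function.Injective f) (hK : IsCompact K)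
    (hr : (affineSpan ℝ K : Set (EuclideanSpace ℝ (Fin m))) = range fun w => p + f w)
    (φ : EuclideanSpace ℝ (Fin m) → ℝ) :
    ∫ y, φ y ∂(uniformLaw K) = (ν.real ((fun w => p + f w) ⁻¹' K))⁻¹ *
      ∫ w in (fun w => p + f w) ⁻¹' K, φ (p + f w) ∂ν := by
  rw [uniformLaw_eq_map ν hf hK hr,
    (isClosedEmbedding_const_add_linearMap f p hf).measurableEmbedding.integral_map, ProbabilityTheory.cond,
    integral_smul_measure, ENNReal.toReal_inv, smul_eq_mul, Measure.real]

end Preimage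

/-! ### Uniform laws on convex bodies -/

section ConvexBody

variable {m : ℕ} {K : Set (EuclideanSpace ℝ (Fin m))}

theorem affineSpan_eq_range {p : EuclideanSpace ℝ (Fin m)} (hp : p ∈ affineSpan ℝ K) :
    (affineSpan ℝ K : Set (EuclideanSpace ℝ (Fin m))) =
      range fun w => p + (affineSpan ℝ K).direction.subtype w := by
  ext y
  constructor
  · intro hy
    exact ⟨⟨y - p, AffineSubspace.vsub_mem_direction hy hp⟩, by simp⟩
  · rintro ⟨w, rfl⟩
    have := AffineSubspace.vadd_mem_of_mem_direction w.2 hp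
    rwa [vadd_eq_add, add_comm] at this

theorem isProbabilityMeasure_uniformLaw (hK : IsCompact K) (hc : Convex ℝ K) (hne : K.Nonempty) :
    IsProbabilityMeasure (uniformLaw K) := by
  obtain ⟨p, hp⟩ := hne
  have hr := affineSpan_eq_range (subset_affineSpan ℝ K hp)
  have hf := (affineSpan ℝ K).direction.injective_subtype
  rw [uniformLaw_eq_map volume hf hK hr]
  have : IsProbabilityMeasure
      (cond volume ((fun w => p + (affineSpan ℝ K).direction.subtype w) ⁻¹' K)) :=
    cond_isProbabilityMeasure_of_finite (measure_preimage_pos volume hf hc hr).ne'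
      (isCompact_preimage_const_add hf hK).measure_lt_top.ne
  exact Measure.isProbabilityMeasure_map
    (isClosedEmbedding_const_add_linearMap _ p hf).continuous.aemeasurable

theorem ae_uniformLaw_mem (hK : IsCompact K) : ∀ᵐ y ∂(uniformLaw K), y ∈ K :=
  ae_cond_mem hK.measurableSet

theorem uniformLaw_self (hK : IsCompact K) (hc : Convex ℝ K) (hne : K.Nonempty) :
    uniformLaw K K = 1 := by
  have := isProbabilityMeasure_uniformLaw hK hc hne
  exact (prob_compl_eq_zero_iff hK.measurableSet).1 (ae_uniformLaw_mem hK)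

theorem integrable_uniformLaw (hK : IsCompact K) (hc : Convex ℝ K) (hne : K.Nonempty)
    {φ : EuclideanSpace ℝ (Fin m) → ℝ} (hφ : Continuous φ) : Integrable φ (uniformLaw K) := by
  have := isProbabilityMeasure_uniformLaw hK hc hne
  obtain ⟨C, hC⟩ := hK.exists_bound_of_continuousOn hφ.continuousOn
  exact Integrable.of_bound hφ.aestronglyMeasurable C ((ae_uniformLaw_mem hK).mono hC)

theorem uniformLaw_vadd (z : EuclideanSpace ℝ (Fin m)) (hK : IsCompact K) (hne : K.Nonempty) :
    uniformLaw (z +ᵥ K) = (uniformLaw K).map fun y => z + y := by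
  obtain ⟨p, hp⟩ := hne
  have hr := affineSpan_eq_range (subset_affineSpan ℝ K hp)
  have hf := (affineSpan ℝ K).direction.injective_subtype
  have himg : (fun w => p + (affineSpan ℝ K).direction.subtype w) ''
      ((fun w => p + (affineSpan ℝ K).direction.subtype w) ⁻¹' K) = K := by
    rw [image_preimage_eq_iff, ← hr]
    exact subset_affineSpan ℝ K
  have hc := isCompact_preimage_const_add (p := p) hf hK
  have hs := affineSpan_preimage_const_add hf hr
  have h1 : z +ᵥ K = (fun w => (z + p) + (affineSpan ℝ K).direction.subtype w) ''
      ((fun w => p + (affineSpan ℝ K).direction.subtype w) ⁻¹' K) := by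
    conv_lhs => rw [← himg]
    rw [← image_vadd, image_image]
    simp [add_assoc]
  rw [h1, uniformLaw_image _ _ volume hf hc hs, uniformLaw_eq_map volume hf hK hr,
    Measure.map_map (by fun_prop)
      (isClosedEmbedding_const_add_linearMap _ p hf).continuous.measurable]
  congr 1
  ext w : 1
  simp [add_assoc]

end ConvexBody

/-- If the preimage of `Q` is null, both sides vanish, whatever the law on the smaller affine hull
of `Q`. Otherwise the preimage spans `F`, as proper affine subspaces are null, and
`uniformLaw_image` applies. Fubini may thus meet degenerate sections. -/
theorem setIntegral_preimage_const_add {m : ℕ} {F : Type*} [NormedAddCommGroup F]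
    [NormedSpace ℝ F] [FiniteDimensional ℝ F] [MeasurableSpace F] [BorelSpace F]
    (ν : Measure F) [ν.IsAddHaarMeasure] {f : F →ₗ[ℝ] EuclideanSpace ℝ (Fin m)}
    {p : EuclideanSpace ℝ (Fin m)} {Q : Set (EuclideanSpace ℝ (Fin m))}
    (hf : Function.Injective f) (hQ : IsCompact Q) (hr : Q ⊆ range fun w => p + f w)
    (φ : EuclideanSpace ℝ (Fin m) → ℝ) :
    ∫ w in (fun w => p + f w) ⁻¹' Q, φ (p + f w) ∂ν =
      ν.real ((fun w => p + f w) ⁻¹' Q) * ∫ y, φ y ∂(uniformLaw Q) := by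
  set Q' := (fun w => p + f w) ⁻¹' Q with hQ'
  rcases eq_or_ne (ν Q') 0 with h0 | h0
  · rw [Measure.restrict_eq_zero.2 h0, Measure.real, h0]
    simp
  have hspan : affineSpan ℝ Q' = ⊤ := by
    by_contra h
    exact h0 (measure_mono_null (subset_affineSpan ℝ Q') (Measure.addHaar_affineSubspace ν _ h))
  have himg : (fun w => p + f w) '' Q' = Q := by rwa [hQ', image_preimage_eq_iff]
  have hc : IsCompact Q' := isCompact_preimage_const_add hf hQ
  conv_rhs => rw [← himg]
  rw [uniformLaw_image f p ν hf hc hspan,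
    (isClosedEmbedding_const_add_linearMap f p hf).measurableEmbedding.integral_map,
    ProbabilityTheory.cond, integral_smul_measure, ENNReal.toReal_inv, smul_eq_mul, Measure.real,
    mul_inv_cancel_left₀]
  exact (ENNReal.toReal_pos h0 hc.measure_lt_top.ne).ne'

/-! ### Sections and half-space cuts -/

section ConvexBody

variable {m : ℕ} {K : Set (EuclideanSpace ℝ (Fin m))}

theorem integral_uniformLaw_congr {φ χ : EuclideanSpace ℝ (Fin m) → ℝ} (hK : IsCompact K)
    (h : ∀ y ∈ K, φ y = χ y) : ∫ y, φ y ∂(uniformLaw K) = ∫ y, χ y ∂(uniformLaw K) :=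
  integral_congr_ae ((ae_uniformLaw_mem hK).mono h)

theorem abs_sub_integral_uniformLaw_le {φ : EuclideanSpace ℝ (Fin m) → ℝ} (hφ : Continuous φ)
    (hK : IsCompact K) (hc : Convex ℝ K) (hne : K.Nonempty) {x C : ℝ}
    (h : ∀ y ∈ K, |x - φ y| ≤ C) : |x - ∫ y, φ y ∂(uniformLaw K)| ≤ C := by
  have := isProbabilityMeasure_uniformLaw hK hc hne
  have h1 : x - ∫ y, φ y ∂(uniformLaw K) = ∫ y, (x - φ y) ∂(uniformLaw K) := by
    rw [integral_sub (integrable_const x) (integrable_uniformLaw hK hc hne hφ)]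
    simp
  rw [h1]
  simpa using norm_integral_le_of_norm_le_const (f := fun y => x - φ y)
    ((ae_uniformLaw_mem hK).mono h)

/-- If a continuous function `ψ` gives the means of `φ` on the sections `{ℓ = t}` of `K`, then
`φ` and `ψ ∘ ℓ` have the same mean on `K`. -/
theorem integral_uniformLaw_eq_of_sections (hK : IsCompact K) (hc : Convex ℝ K)
    (hne : K.Nonempty) (l : EuclideanSpace ℝ (Fin m) →ₗ[ℝ] ℝ)
    {φ : EuclideanSpace ℝ (Fin m) → ℝ} (hφ : Continuous φ) {ψ : ℝ → ℝ} (hψ : Continuous ψ)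
    (h : ∀ t, (K ∩ {y | l y = t}).Nonempty →
      ∫ y, φ y ∂(uniformLaw (K ∩ {y | l y = t})) = ψ t) :
    ∫ y, φ y ∂(uniformLaw K) = ∫ y, ψ (l y) ∂(uniformLaw K) := by
  obtain ⟨y₀, hy₀⟩ := hne
  have hlc : Continuous l := l.continuous_of_finiteDimensional
  set W := (affineSpan ℝ K).direction with hW
  by_cases hconst : ∀ w ∈ W, l w = 0
  · have hl : ∀ y ∈ K, l y = l y₀ := fun y hy => by
      have := hconst (y - y₀) (AffineSubspace.vsub_mem_direction
        (subset_affineSpan ℝ K hy) (subset_affineSpan ℝ K hy₀))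
      rwa [map_sub, sub_eq_zero] at this
    have hKt : K ∩ {y | l y = l y₀} = K := inter_eq_left.2 hl
    have h1 := h (l y₀) ⟨y₀, hy₀, rfl⟩
    have := isProbabilityMeasure_uniformLaw hK hc ⟨y₀, hy₀⟩
    rw [hKt] at h1
    rw [h1, integral_uniformLaw_congr (χ := fun _ => ψ (l y₀)) hK fun y hy => by rw [hl y hy]]
    simp
  push Not at hconst
  obtain ⟨w, hw, hlw⟩ := hconst
  -- Coordinates `(w, t)` on the affine hull with `w` in `ker l`. The base point `p` below satisfies
  -- `l p = 0`, so that `t` is the value of `l`.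
  obtain ⟨u, hu, hlu⟩ : ∃ u ∈ W, l u = 1 :=
    ⟨(l w)⁻¹ • w, W.smul_mem _ hw, by simp [hlw]⟩
  let W₀ : Submodule ℝ (EuclideanSpace ℝ (Fin m)) := W ⊓ LinearMap.ker l
  have hlW₀ : ∀ w : W₀, l w = 0 := fun w => w.2.2
  let f : W₀ × ℝ →ₗ[ℝ] EuclideanSpace ℝ (Fin m) :=
    W₀.subtype.coprod (LinearMap.toSpanSingleton ℝ _ u)
  have hfa : ∀ w t, f (w, t) = w + t • u := fun w t => by simp [f]
  let p := y₀ - l y₀ • u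
  have hlf : ∀ w t, l (p + f (w, t)) = t := fun w t => by simp [p, hfa, hlW₀, hlu]
  have hf : Function.Injective f := by
    rintro ⟨w, t⟩ ⟨w', t'⟩ hww
    have ht : t = t' := by rw [← hlf w t, hww, hlf]
    subst ht
    rw [hfa, hfa, add_left_inj] at hww
    rw [Subtype.ext hww]
  have hr : (affineSpan ℝ K : Set (EuclideanSpace ℝ (Fin m))) = range fun w => p + f w := by
    rw [affineSpan_eq_range (subset_affineSpan ℝ K hy₀)]
    apply Subset.antisymm
    · rintro _ ⟨w, rfl⟩
      refine ⟨(⟨w - l w • u, W.sub_mem w.2 (W.smul_mem _ hu), by simp [hlu]⟩, l w + l y₀), ?_⟩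
      simp only [hfa, p, Submodule.subtype_apply]
      module
    · rintro _ ⟨⟨w, t⟩, rfl⟩
      refine ⟨⟨w + (t - l y₀) • u, W.add_mem w.2.1 (W.smul_mem _ hu)⟩, ?_⟩
      simp only [hfa, p, Submodule.subtype_apply]
      module
  -- Since any Haar measure will do, `u` need not be a unit vector orthogonal to `W₀`.
  let ν : Measure (W₀ × ℝ) := (volume : Measure W₀).prod volume
  set K' := (fun w => p + f w) ⁻¹' K with hK'def
  have hK' : IsCompact K' := isCompact_preimage_const_add hf hK
  have hfc : Continuous fun w => p + f w := (isClosedEmbedding_const_add_linearMap f p hf).continuous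
  have key : ∀ χ : EuclideanSpace ℝ (Fin m) → ℝ, Continuous χ →
      ∫ w in K', χ (p + f w) ∂ν = ∫ t, (volume : Measure W₀).real
        ((fun w : W₀ => (p + t • u) + W₀.subtype w) ⁻¹' (K ∩ {y | l y = t})) *
          ∫ y, χ y ∂(uniformLaw (K ∩ {y | l y = t})) := by
    intro χ hχ
    have hi : Integrable (K'.indicator fun w => χ (p + f w)) ν :=
      ((hχ.comp hfc).continuousOn.integrableOn_compact hK').integrable_indicator hK'.measurableSet
    rw [← integral_indicator hK'.measurableSet, integral_prod_symm _ hi]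
    refine integral_congr_ae (.of_forall fun t => ?_)
    have hpre : ∀ w : W₀, (w, t) ∈ K' ↔
        w ∈ (fun w : W₀ => (p + t • u) + W₀.subtype w) ⁻¹' (K ∩ {y | l y = t}) := fun w => by
      have h1 : p + t • u + (w : EuclideanSpace ℝ (Fin m)) = p + f (w, t) := by
        rw [hfa]; module
      simp only [hK'def, mem_preimage, Submodule.subtype_apply, h1, mem_inter_iff, mem_ofPred_eq, hlf,
        and_true]
    have hQ : IsCompact (K ∩ {y | l y = t}) :=
      hK.inter_right (isClosed_eq hlc continuous_const)
    beta_reduce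
    rw [← setIntegral_preimage_const_add volume W₀.injective_subtype hQ, ← integral_indicator]
    · refine integral_congr_ae (.of_forall fun w => ?_)
      have h1 : p + t • u + W₀.subtype w = p + f (w, t) := by
        rw [hfa, Submodule.subtype_apply]; module
      beta_reduce
      by_cases hwK : (w, t) ∈ K'
      · rw [indicator_of_mem hwK, indicator_of_mem ((hpre w).1 hwK), h1]
      · rw [indicator_of_notMem hwK, indicator_of_notMem (mt (hpre w).2 hwK)]
    · exact (isCompact_preimage_const_add W₀.injective_subtype hQ).measurableSet
    · rintro y ⟨hy, rfl⟩
      have hy' : y ∈ range fun w => p + f w := hr ▸ subset_affineSpan ℝ K hy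
      obtain ⟨⟨w, t⟩, rfl⟩ := hy'
      refine ⟨w, ?_⟩
      change p + l (p + f (w, t)) • u + (w : EuclideanSpace ℝ (Fin m)) = p + f (w, t)
      rw [hlf, hfa]
      module
  rw [integral_uniformLaw ν hf hK hr, integral_uniformLaw ν hf hK hr, key φ hφ,
    key (fun y => ψ (l y)) (hψ.comp hlc)]
  congr 1
  refine integral_congr_ae (.of_forall fun t => ?_)
  have hQ : IsCompact (K ∩ {y | l y = t}) :=
    hK.inter_right (isClosed_eq hlc continuous_const)
  rcases (K ∩ {y | l y = t}).eq_empty_or_nonempty with he | hn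
  · simp [he]
  · have hQc : Convex ℝ (K ∩ {y | l y = t}) := hc.inter (convex_hyperplane l.isLinear t)
    have := isProbabilityMeasure_uniformLaw hQ hQc hn
    simp only
    rw [h t hn, integral_uniformLaw_congr (χ := fun _ => ψ t) hQ fun y hy => by rw [hy.2]]
    simp

/-- Cutting `K` by the half-space `{ℓ ≤ T}` moves the mean of a Lipschitz function of `ℓ` by at
most a multiple of the width of the part cut off. -/
theorem abs_integral_comp_uniformLaw_sub_le (hK : IsCompact K) (hc : Convex ℝ K)
    (l : EuclideanSpace ℝ (Fin m) →ₗ[ℝ] ℝ) {b T : ℝ} (hb : ∀ y ∈ K, l y ≤ b)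
    (hT : (K ∩ {y | l y ≤ T}).Nonempty) (hTb : T ≤ b) {ψ : ℝ → ℝ} {L : NNReal}
    (hψ : LipschitzWith L ψ) :
    |∫ y, ψ (l y) ∂(uniformLaw K) - ∫ y, ψ (l y) ∂(uniformLaw (K ∩ {y | l y ≤ T}))| ≤
      (m + 1) * L * (b - T) := by
  have hlc : Continuous l := l.continuous_of_finiteDimensional
  have hψl : Continuous fun y => ψ (l y) := hψ.continuous.comp hlc
  have hne : K.Nonempty := hT.mono inter_subset_left
  set KT := K ∩ {y | l y ≤ T} with hKTdef
  have hKT : IsCompact KT := hK.inter_right (isClosed_le hlc continuous_const)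
  have hcT : Convex ℝ KT := hc.inter (convex_halfSpace_le l.isLinear T)
  obtain ⟨y₀, hy₀, hmin⟩ := hK.exists_isMinOn hne hlc.continuousOn
  have hmin : ∀ y ∈ K, l y₀ ≤ l y := fun y hy => hmin hy
  have haT : l y₀ ≤ T := by
    obtain ⟨y, hy, hyT⟩ := hT
    exact (hmin y hy).trans hyT
  set e := ∫ y, ψ (l y) ∂(uniformLaw KT) with he
  have hosc : ∀ y ∈ K, |ψ (l y) - e| ≤ L * (b - l y₀) := by
    intro y hy
    refine abs_sub_integral_uniformLaw_le hψl hKT hcT hT fun z hz => ?_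
    have h1 := hψ.dist_le_mul (l y) (l z)
    rw [Real.dist_eq, Real.dist_eq] at h1
    refine h1.trans (mul_le_mul_of_nonneg_left ?_ L.2)
    rw [abs_le]
    constructor <;> linarith [hb y hy, hmin y hy, hb z hz.1, hmin z hz.1]
  -- If `T` is the minimum of `l`, the oscillation bound alone suffices; it accounts for the `1` in
  -- `m + 1`.
  rcases haT.eq_or_lt with haT | haT
  · rw [abs_sub_comm]
    refine (abs_sub_integral_uniformLaw_le hψl hK hc hne
      fun y hy => (abs_sub_comm _ _).trans_le (hosc y hy)).trans ?_
    rw [haT]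
    have : 0 ≤ (m : ℝ) * (L * (b - T)) := by
      have := L.2
      have := sub_nonneg.2 hTb
      positivity
    linarith
  let W := (affineSpan ℝ K).direction
  have hr := affineSpan_eq_range (subset_affineSpan ℝ K hy₀)
  have hf : Function.Injective W.subtype := W.injective_subtype
  have hsub : K ⊆ range fun w => y₀ + W.subtype w := hr ▸ subset_affineSpan ℝ K
  have hfc : Continuous fun w => y₀ + W.subtype w :=
    (isClosedEmbedding_const_add_linearMap _ y₀ hf).continuous
  set K' := (fun w => y₀ + W.subtype w) ⁻¹' K with hK'def
  set KT' := (fun w => y₀ + W.subtype w) ⁻¹' KT with hKT'def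
  have hK' : IsCompact K' := isCompact_preimage_const_add hf hK
  have hKT' : IsCompact KT' := isCompact_preimage_const_add hf hKT
  have hsub' : KT' ⊆ K' := preimage_mono inter_subset_left
  have hpos : 0 < volume.real K' :=
    ENNReal.toReal_pos (measure_preimage_pos volume hf hc hr).ne' hK'.measure_lt_top.ne
  have hχ : Continuous fun y => ψ (l y) - e := hψl.sub continuous_const
  have hiK := isProbabilityMeasure_uniformLaw hK hc hne
  have hiKT := isProbabilityMeasure_uniformLaw hKT hcT hT
  -- Centring at `e` makes the integral over `KT'` vanish, so only the part cut off contributes.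
  have h1 := setIntegral_preimage_const_add volume hf hK hsub fun y => ψ (l y) - e
  have h2 := setIntegral_preimage_const_add volume hf hKT (inter_subset_left.trans hsub)
    fun y => ψ (l y) - e
  rw [integral_sub (integrable_uniformLaw hK hc hne hψl) (integrable_const e)] at h1
  rw [integral_sub (integrable_uniformLaw hKT hcT hT hψl) (integrable_const e)] at h2
  simp only [integral_const, probReal_univ, one_smul] at h1 h2
  rw [← he, sub_self, mul_zero] at h2
  have hint : IntegrableOn (fun w => ψ (l (y₀ + W.subtype w)) - e) K' volume :=
    (hχ.comp hfc).continuousOn.integrableOn_compact hK'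
  have h3 := setIntegral_sdiff hKT'.measurableSet hint hsub'
  have hbd : |∫ w in K' \ KT', (ψ (l (y₀ + W.subtype w)) - e)| ≤
      L * (b - l y₀) * volume.real (K' \ KT') := by
    exact norm_setIntegral_le_of_norm_le_const (μ := volume) (s := K' \ KT')
      (f := fun w => ψ (l (y₀ + W.subtype w)) - e)
      ((measure_mono sdiff_subset).trans_lt hK'.measure_lt_top) fun w hw => hosc _ hw.1
  rw [h3, h1, h2, sub_zero, abs_mul, abs_of_pos hpos,
    measureReal_sdiff hsub' hKT'.measurableSet hK'.measure_lt_top.ne] at hbd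
  have hab : 0 < b - l y₀ := by linarith
  set θ := (T - l y₀) / (b - l y₀) with hθ
  have hθ0 : 0 ≤ θ := div_nonneg (by linarith) hab.le
  have hθ1 : θ ≤ 1 := (div_le_one hab).2 (by linarith)
  -- The minimizer `y₀` has coordinate `0`, so this is the homothety centred at `y₀`.
  have hscale : θ • K' ⊆ KT' := by
    rintro _ ⟨w, hw, rfl⟩
    have h4 : y₀ + W.subtype (θ • w) = (1 - θ) • y₀ + θ • (y₀ + W.subtype w) := by
      rw [map_smul]; module
    have hw' : y₀ + W.subtype w ∈ K := hw
    simp only [hKT'def, mem_preimage, hKTdef, mem_inter_iff, mem_ofPred_eq, h4]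
    refine ⟨hc hy₀ hw' (by linarith) hθ0 (by ring), ?_⟩
    rw [map_add, map_smul, map_smul, smul_eq_mul, smul_eq_mul]
    have h5 : θ * (l (y₀ + W.subtype w) - l y₀) ≤ θ * (b - l y₀) :=
      mul_le_mul_of_nonneg_left (by linarith [hb _ hw']) hθ0
    rw [hθ, div_mul_cancel₀ _ hab.ne', ← hθ] at h5
    linarith
  have hvol : θ ^ finrank ℝ W * volume.real K' ≤ volume.real KT' := by
    have h6 := measureReal_mono (μ := volume) hscale hKT'.measure_lt_top.ne
    rwa [Measure.real, Measure.addHaar_smul_of_nonneg _ hθ0, ENNReal.toReal_mul,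
      ENNReal.toReal_ofReal (by positivity)] at h6
  -- Bernoulli's inequality, with the dimension bounded by `m`.
  have hbern : 1 - θ ^ finrank ℝ W ≤ m * (1 - θ) := by
    have h7 := one_add_mul_le_pow (a := θ - 1) (by linarith) (finrank ℝ W)
    have h8 : (finrank ℝ W : ℝ) ≤ m := by
      have := W.finrank_le
      rw [finrank_euclideanSpace_fin] at this
      exact_mod_cast this
    have h9 := mul_le_mul_of_nonneg_right h8 (sub_nonneg.2 hθ1)
    rw [add_sub_cancel] at h7
    linarith
  set D := |∫ y, ψ (l y) ∂(uniformLaw K) - e|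
  have hD : D ≤ L * (b - l y₀) * (1 - θ ^ finrank ℝ W) := by
    have h10 : volume.real K' * D ≤
        volume.real K' * (L * (b - l y₀) * (1 - θ ^ finrank ℝ W)) := by
      refine hbd.trans ?_
      have : 0 ≤ (L : ℝ) * (b - l y₀) := mul_nonneg L.2 hab.le
      nlinarith
    exact le_of_mul_le_mul_left h10 hpos
  have hfin : L * (b - l y₀) * (m * (1 - θ)) = m * L * (b - T) := by
    rw [hθ]; field_simp; ring
  have h11 := mul_le_mul_of_nonneg_left hbern (mul_nonneg L.2 hab.le)
  have h12 : 0 ≤ (L : ℝ) * (b - T) := mul_nonneg L.2 (by linarith)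
  change (L : ℝ) * (b - l y₀) * _ ≤ (L : ℝ) * (b - l y₀) * _ at h11
  linarith

theorem abs_mean_sub_mean_inter_halfSpace_le {φ : EuclideanSpace ℝ (Fin m) → ℝ}
    (hφ : Continuous φ) (hK : IsCompact K) (hc : Convex ℝ K)
    (l : EuclideanSpace ℝ (Fin m) →ₗ[ℝ] ℝ) {b T : ℝ} (hb : ∀ y ∈ K, l y ≤ b)
    (hT : (K ∩ {y | l y ≤ T}).Nonempty) (hTb : T ≤ b) {L : NNReal}
    (h : ∀ t t', (K ∩ {y | l y = t}).Nonempty → (K ∩ {y | l y = t'}).Nonempty →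
      |∫ y, φ y ∂(uniformLaw (K ∩ {y | l y = t})) -
        ∫ y, φ y ∂(uniformLaw (K ∩ {y | l y = t'}))| ≤ L * |t - t'|) :
    |∫ y, φ y ∂(uniformLaw K) - ∫ y, φ y ∂(uniformLaw (K ∩ {y | l y ≤ T}))| ≤
      (m + 1) * L * (b - T) := by
  have hlc : Continuous l := l.continuous_of_finiteDimensional
  have hlip : LipschitzOnWith L (fun t => ∫ y, φ y ∂(uniformLaw (K ∩ {y | l y = t})))
      {t | (K ∩ {y | l y = t}).Nonempty} :=
    LipschitzOnWith.of_dist_le_mul fun t ht t' ht' => by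
      simpa only [Real.dist_eq] using h t t' ht ht'
  -- The section mean is controlled only where the section is nonempty; the extension is Lipschitz
  -- on all of `ℝ`.
  obtain ⟨ψ, hψ, hψe⟩ := hlip.extend_real
  rw [integral_uniformLaw_eq_of_sections hK hc (hT.mono inter_subset_left) l hφ hψ.continuous
      fun t ht => hψe ht,
    integral_uniformLaw_eq_of_sections (hK.inter_right (isClosed_le hlc continuous_const))
      (hc.inter (convex_halfSpace_le l.isLinear T)) hT l hφ hψ.continuous]
  · exact abs_integral_comp_uniformLaw_sub_le hK hc l hb hT hTb hψ
  -- A nonempty section of the cut body is a section of `K`, so the same `ψ` serves both.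
  · rintro t ⟨y, ⟨hy, hyT⟩, hyt⟩
    have hset : K ∩ {y | l y ≤ T} ∩ {y | l y = t} = K ∩ {y | l y = t} := by
      ext z
      simp only [mem_inter_iff, mem_ofPred_eq] at hyT hyt ⊢
      constructor
      · exact fun hz => ⟨hz.1.1, hz.2⟩
      · exact fun hz => ⟨⟨hz.1, by rw [hz.2, ← hyt]; exact hyT⟩, hz.2⟩
    rw [hset]
    exact hψe ⟨y, hy, hyt⟩

end ConvexBody

/-! ### Lipschitz dependence on the right-hand side -/

/-- Both points are joined to `β ⊔ β'` by raising one coordinate at a time, which never leaves an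
upper set. The two legs give the factor `2`. -/
theorem abs_sub_le_of_coordinate_steps {ι : Type*} [Fintype ι] [DecidableEq ι]
    {U : Set (ι → ℝ)} (hU : IsUpperSet U) {f : (ι → ℝ) → ℝ} {C : ι → NNReal}
    (hstep : ∀ β ∈ U, ∀ i s, 0 ≤ s → |f (β + Pi.single i s) - f β| ≤ C i * s)
    {β β' : ι → ℝ} (hβ : β ∈ U) (hβ' : β' ∈ U) :
    |f β - f β'| ≤ ↑(2 * ∑ i, C i) * ‖β - β'‖ := by
  have hmono : ∀ β ∈ U, ∀ s : ι → ℝ, 0 ≤ s → |f (β + s) - f β| ≤ ∑ i, C i * s i := by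
    intro β hβ s hs
    have h : ∀ S : Finset ι,
        |f (β + ∑ i ∈ S, Pi.single i (s i)) - f β| ≤ ∑ i ∈ S, C i * s i := by
      intro S
      induction S using Finset.induction_on with
      | empty => simp
      | insert i S hi ih =>
        rw [Finset.sum_insert hi, Finset.sum_insert hi, add_comm (Pi.single i (s i) : ι → ℝ), ← add_assoc]
        have h0 : 0 ≤ ∑ i ∈ S, (Pi.single i (s i) : ι → ℝ) :=
          Finset.sum_nonneg fun j _ => Pi.single_nonneg.2 (hs j)
        have h1 := hstep _ (hU (le_add_of_nonneg_right h0) hβ) i (s i) (hs i)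
        exact (abs_sub_le _ _ _).trans (add_le_add h1 ih)
    simpa [Finset.univ_sum_single] using h Finset.univ
  have hbound : ∀ β ∈ U, ∀ s : ι → ℝ, 0 ≤ s → ∀ r, (∀ i, s i ≤ r) →
      |f (β + s) - f β| ≤ (∑ i, (C i : ℝ)) * r := fun β hβ s hs r hr => by
    refine (hmono β hβ s hs).trans ?_
    rw [Finset.sum_mul]
    exact Finset.sum_le_sum fun i _ => mul_le_mul_of_nonneg_left (hr i) (C i).2
  have hnorm : ∀ i, |β i - β' i| ≤ ‖β - β'‖ := fun i => norm_le_pi_norm (β - β') i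
  have h1 := hbound β hβ (β ⊔ β' - β) (sub_nonneg.2 le_sup_left) ‖β - β'‖ fun i => by
    have := abs_le.1 (hnorm i)
    simp only [Pi.sub_apply, Pi.sup_apply, sub_le_iff_le_add, sup_le_iff]
    constructor <;> linarith [norm_nonneg (β - β')]
  have h2 := hbound β' hβ' (β ⊔ β' - β') (sub_nonneg.2 le_sup_right) ‖β - β'‖ fun i => by
    have := abs_le.1 (hnorm i)
    simp only [Pi.sub_apply, Pi.sup_apply, sub_le_iff_le_add, sup_le_iff]
    constructor <;> linarith [norm_nonneg (β - β')]
  rw [add_sub_cancel] at h1 h2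
  rw [abs_sub_comm] at h1
  push_cast
  linarith [abs_sub_le (f β) (f (β ⊔ β')) (f β')]

section Polytope

variable {ι E : Type*} [NormedAddCommGroup E] [NormedSpace ℝ E]

/-- The polyhedron cut out of the subspace `V` by the inequalities `M i y ≤ β i`. -/
def polytope (M : ι → E →ₗ[ℝ] ℝ) (V : Submodule ℝ E) (β : ι → ℝ) : Set E :=
  {y | y ∈ V ∧ ∀ i, M i y ≤ β i}

variable (M : ι → E →ₗ[ℝ] ℝ) (V : Submodule ℝ E)

theorem polytope_mono {β β' : ι → ℝ} (h : β ≤ β') : polytope M V β ⊆ polytope M V β' :=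
  fun _ hy => ⟨hy.1, fun i => (hy.2 i).trans (h i)⟩

theorem convex_polytope (β : ι → ℝ) : Convex ℝ (polytope M V β) := by
  have : polytope M V β = (V : Set E) ∩ ⋂ i, {y | M i y ≤ β i} := by
    ext y; simp [polytope]
  rw [this]
  exact V.convex.inter (convex_iInter fun i => convex_halfSpace_le (M i).isLinear _)

theorem isCompact_polytope [FiniteDimensional ℝ E]
    (hM : ∀ β : ι → ℝ, Bornology.IsBounded (polytope M ⊤ β)) (β : ι → ℝ) :
    IsCompact (polytope M V β) := by
  have : polytope M V β = (V : Set E) ∩ ⋂ i, {y | M i y ≤ β i} := by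
    ext y; simp [polytope]
  refine Metric.isCompact_of_isClosed_isBounded ?_
    ((hM β).subset fun y hy => ⟨Submodule.mem_top, hy.2⟩)
  rw [this]
  exact V.closed_of_finiteDimensional.inter (isClosed_iInter fun i =>
    isClosed_le (M i).continuous_of_finiteDimensional continuous_const)

/-- Sectioning shrinks `V` but keeps the rows, which lets the induction run on `V` alone. -/
theorem polytope_inter_eq {i : ι} {u : E} (hu : u ∈ V) (hMu : M i u = 1) (β : ι → ℝ) (t : ℝ) :
    polytope M V β ∩ {y | M i y = t} =
      t • u +ᵥ polytope M (V ⊓ LinearMap.ker (M i)) (β - t • fun j => M j u) := by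
  ext y
  rw [mem_vadd_set_iff_neg_vadd_mem]
  simp only [polytope, vadd_eq_add, mem_inter_iff, mem_ofPred_eq, Submodule.mem_inf,
    LinearMap.mem_ker, map_add, map_neg, map_smul, hMu, smul_eq_mul, mul_one, Pi.sub_apply,
    Pi.smul_apply]
  have h1 : -(t • u) + y ∈ V ↔ y ∈ V := V.add_mem_iff_right (V.neg_mem (V.smul_mem t hu))
  rw [h1]
  constructor
  · rintro ⟨⟨hy, hyM⟩, hyt⟩
    exact ⟨⟨hy, by linarith⟩, fun j => by linarith [hyM j]⟩
  · rintro ⟨⟨hy, hyt⟩, hyM⟩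
    exact ⟨⟨hy, fun j => by linarith [hyM j]⟩, by linarith⟩

/-- A translation covariant functional of convex bodies that behaves well under cutting off by
half-spaces is Lipschitz in the right-hand side of a system of inequalities. -/
theorem exists_lipschitz_polytope [Fintype ι] [FiniteDimensional ℝ E]
    (hM : ∀ β : ι → ℝ, Bornology.IsBounded (polytope M ⊤ β)) (Φ : Set E → ℝ) (κ : E →ₗ[ℝ] ℝ)
    (C : NNReal)
    (hvadd : ∀ (z : E) (K : Set E), IsCompact K → Convex ℝ K → K.Nonempty → Φ (z +ᵥ K) = κ z + Φ K)
    (hcut : ∀ K : Set E, IsCompact K → Convex ℝ K → ∀ (l : E →ₗ[ℝ] ℝ) (b T : ℝ),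
      (∀ y ∈ K, l y ≤ b) → (K ∩ {y | l y ≤ T}).Nonempty → T ≤ b → ∀ L : NNReal,
      (∀ t t', (K ∩ {y | l y = t}).Nonempty → (K ∩ {y | l y = t'}).Nonempty →
        |Φ (K ∩ {y | l y = t}) - Φ (K ∩ {y | l y = t'})| ≤ L * |t - t'|) →
      |Φ K - Φ (K ∩ {y | l y ≤ T})| ≤ C * L * (b - T)) :
    ∃ L : NNReal, ∀ β β' : ι → ℝ, (polytope M V β).Nonempty → (polytope M V β').Nonempty →
      |Φ (polytope M V β) - Φ (polytope M V β')| ≤ L * ‖β - β'‖ := by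
  classical
  induction hd : finrank ℝ V using Nat.strong_induction_on generalizing V with
  | _ d ih =>
  subst hd
  have hstep : ∀ i, ∃ D : NNReal, ∀ β ∈ {β | (polytope M V β).Nonempty}, ∀ s : ℝ, 0 ≤ s →
      |Φ (polytope M V (β + Pi.single i s)) - Φ (polytope M V β)| ≤ D * s := by
    intro i
    by_cases h0 : ∀ w ∈ V, M i w = 0
    -- Here the constraint `i` reads `0 ≤ β i` on `V`; it holds by nonemptiness, and relaxing it
    -- changes nothing.
    · refine ⟨0, fun β ⟨y₀, hy₀⟩ s hs => ?_⟩
      have heq : polytope M V (β + Pi.single i s) = polytope M V β := by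
        refine Subset.antisymm (fun y hy => ⟨hy.1, fun j => ?_⟩)
          (polytope_mono M V (le_add_of_nonneg_right (Pi.single_nonneg.2 hs)))
        rcases eq_or_ne j i with rfl | hj
        · rw [h0 y hy.1, ← h0 y₀ hy₀.1]
          exact hy₀.2 j
        · simpa [hj] using hy.2 j
      simp [heq]
    push Not at h0
    obtain ⟨w, hw, hMw⟩ := h0
    obtain ⟨u, hu, hMu⟩ : ∃ u ∈ V, M i u = 1 := ⟨(M i w)⁻¹ • w, V.smul_mem _ hw, by simp [hMw]⟩
    have hlt : finrank ℝ ↥(V ⊓ LinearMap.ker (M i)) < finrank ℝ V := by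
      refine Submodule.finrank_lt_finrank_of_lt (lt_of_le_of_ne inf_le_left fun h => ?_)
      have : u ∈ V ⊓ LinearMap.ker (M i) := h.ge hu
      rw [Submodule.mem_inf, LinearMap.mem_ker, hMu] at this
      exact one_ne_zero this.2
    obtain ⟨L₀, hL₀⟩ := ih _ hlt _ rfl
    -- Per unit of `t`, the right-hand side of the section moves by the vector of the `M j u` and
    -- its translation changes `Φ` by `κ u`.
    refine ⟨C * (L₀ * ‖fun j => M j u‖₊ + ‖κ u‖₊), fun β hβ s hs => ?_⟩
    have hle : β ≤ β + Pi.single i s := le_add_of_nonneg_right (Pi.single_nonneg.2 hs)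
    have hinter : polytope M V (β + Pi.single i s) ∩ {y | M i y ≤ β i} = polytope M V β := by
      refine Subset.antisymm (fun y hy => ⟨hy.1.1, fun j => ?_⟩)
        fun y hy => ⟨polytope_mono M V hle hy, hy.2 i⟩
      rcases eq_or_ne j i with rfl | hj
      · exact hy.2
      · simpa [hj] using hy.1.2 j
    have h1 := hcut (polytope M V (β + Pi.single i s)) (isCompact_polytope M V hM _)
      (convex_polytope M V _) (M i) (β i + s) (β i)
      (fun y hy => by simpa using hy.2 i) (by rw [hinter]; exact hβ) (by linarith)
      (L₀ * ‖fun j => M j u‖₊ + ‖κ u‖₊) fun t t' ht ht' => ?_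
    · rw [hinter, add_sub_cancel_left] at h1
      exact_mod_cast h1
    · rw [polytope_inter_eq M V hu hMu] at ht ht' ⊢
      rw [polytope_inter_eq M V hu hMu]
      rw [vadd_set_nonempty] at ht ht'
      rw [hvadd _ _ (isCompact_polytope M _ hM _) (convex_polytope M _ _) ht,
        hvadd _ _ (isCompact_polytope M _ hM _) (convex_polytope M _ _) ht']
      have h2 := hL₀ _ _ ht ht'
      have h3 : (β + Pi.single i s - t • fun j => M j u) -
          (β + Pi.single i s - t' • fun j => M j u) = (t' - t) • fun j => M j u := by
        module
      rw [h3, norm_smul, Real.norm_eq_abs, abs_sub_comm t' t] at h2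
      have h4 : |κ (t • u) - κ (t' • u)| = ‖κ u‖ * |t - t'| := by
        rw [map_smul, map_smul, ← sub_smul, smul_eq_mul, abs_mul, mul_comm, Real.norm_eq_abs]
      rw [add_sub_add_comm]
      refine (abs_add_le _ _).trans ?_
      rw [h4]
      push_cast
      linarith
  choose D hD using hstep
  exact ⟨_, fun β β' hβ hβ' => abs_sub_le_of_coordinate_steps
    (U := {β | (polytope M V β).Nonempty}) (f := fun β => Φ (polytope M V β)) (C := D)
    (fun β β' h hβ => hβ.mono (polytope_mono M V h)) (fun β hβ i s hs => hD i β hβ s hs) hβ hβ'⟩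

end Polytope

/-! ### Minimum of a linear form under cuts -/

section Minimum

variable {E : Type*} [NormedAddCommGroup E] [NormedSpace ℝ E] [FiniteDimensional ℝ E]

theorem isLeast_sInf_image {K : Set E} (hK : IsCompact K) (hne : K.Nonempty) (κ : E →ₗ[ℝ] ℝ) :
    IsLeast (κ '' K) (sInf (κ '' K)) :=
  (hK.image κ.continuous_of_finiteDimensional).isLeast_sInf (hne.image κ)

theorem sInf_image_vadd {K : Set E} (hK : IsCompact K) (hne : K.Nonempty) (κ : E →ₗ[ℝ] ℝ) (z : E) :
    sInf (κ '' (z +ᵥ K)) = κ z + sInf (κ '' K) := by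
  obtain ⟨⟨y, hy, hyκ⟩, hmin⟩ := isLeast_sInf_image hK hne κ
  refine IsLeast.csInf_eq ⟨⟨z + y, vadd_mem_vadd_set hy, by rw [map_add, hyκ]⟩, ?_⟩
  rintro _ ⟨_, ⟨w, hw, rfl⟩, rfl⟩
  simpa using hmin ⟨w, hw, rfl⟩

/-- Only a minimizer `y` with `l y > T` matters. By convexity the section `l = T` is then nonempty,
and its minimum exceeds that of the section through `y` by at most `L (l y - T)`. -/
theorem abs_sInf_image_sub_le {K : Set E} (hK : IsCompact K) (hc : Convex ℝ K) (κ l : E →ₗ[ℝ] ℝ)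
    {b T : ℝ} (hb : ∀ y ∈ K, l y ≤ b) (hT : (K ∩ {y | l y ≤ T}).Nonempty) (hTb : T ≤ b)
    {L : NNReal}
    (h : ∀ t t', (K ∩ {y | l y = t}).Nonempty → (K ∩ {y | l y = t'}).Nonempty →
      |sInf (κ '' (K ∩ {y | l y = t})) - sInf (κ '' (K ∩ {y | l y = t'}))| ≤ L * |t - t'|) :
    |sInf (κ '' K) - sInf (κ '' (K ∩ {y | l y ≤ T}))| ≤ L * (b - T) := by
  have hlc : Continuous l := l.continuous_of_finiteDimensional
  have hlt : ∀ t, IsCompact (K ∩ {y | l y = t}) := fun t =>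
    hK.inter_right (isClosed_eq hlc continuous_const)
  obtain ⟨⟨y, hy, hyκ⟩, hmin⟩ := isLeast_sInf_image hK (hT.mono inter_subset_left) κ
  obtain ⟨⟨yT, hyT, hyTκ⟩, hminT⟩ := isLeast_sInf_image
    (hK.inter_right (isClosed_le hlc continuous_const)) hT κ
  have h1 : sInf (κ '' K) ≤ sInf (κ '' (K ∩ {y | l y ≤ T})) := by
    rw [← hyTκ]; exact hmin ⟨yT, hyT.1, rfl⟩
  have h0 : 0 ≤ L * (b - T) := mul_nonneg L.2 (sub_nonneg.2 hTb)
  rw [abs_sub_comm, abs_of_nonneg (sub_nonneg.2 h1), sub_le_iff_le_add]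
  rcases le_or_gt (l y) T with hyl | hyl
  · have := hminT ⟨y, ⟨hy, hyl⟩, rfl⟩
    linarith
  obtain ⟨z, hz, hzT⟩ := hT
  obtain ⟨x, hx, hxT⟩ : T ∈ l '' K := (hc.linear_image l).ordConnected.out
    (mem_image_of_mem l hz) (mem_image_of_mem l hy) ⟨hzT, hyl.le⟩
  have hne : (K ∩ {y | l y = T}).Nonempty := ⟨x, hx, hxT⟩
  have hne' : (K ∩ {z | l z = l y}).Nonempty := ⟨y, hy, rfl⟩
  have h2 := h T (l y) hne hne'
  obtain ⟨⟨x', hx', hx'κ⟩, -⟩ := isLeast_sInf_image (hlt T) hne κ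
  have h3 := (isLeast_sInf_image (hlt (l y)) hne' κ).2 ⟨y, ⟨hy, rfl⟩, rfl⟩
  have h4 := hminT ⟨x', ⟨hx'.1, (show l x' = T from hx'.2).le⟩, rfl⟩
  rw [abs_sub_comm T, abs_of_pos (sub_pos.2 hyl)] at h2
  have h5 : L * (l y - T) ≤ L * (b - T) := mul_le_mul_of_nonneg_left (by linarith [hb y hy]) L.2
  linarith [(abs_le.1 h2).2]

end Minimum

theorem mean_vadd {m : ℕ} {K : Set (EuclideanSpace ℝ (Fin m))} (hK : IsCompact K)
    (hc : Convex ℝ K) (hne : K.Nonempty) (κ : EuclideanSpace ℝ (Fin m) →ₗ[ℝ] ℝ)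
    (z : EuclideanSpace ℝ (Fin m)) :
    ∫ y, κ y ∂(uniformLaw (z +ᵥ K)) = κ z + ∫ y, κ y ∂(uniformLaw K) := by
  have := isProbabilityMeasure_uniformLaw hK hc hne
  rw [uniformLaw_vadd z hK hne, (measurableEmbedding_addLeft z).integral_map]
  simp only [map_add]
  rw [integral_add (integrable_const _)
    (integrable_uniformLaw hK hc hne κ.continuous_of_finiteDimensional)]
  simp

/-- The linear form `y ↦ v ⬝ᵥ y`. -/
noncomputable def dotForm {k : ℕ} (v : Fin k → ℝ) : EuclideanSpace ℝ (Fin k) →ₗ[ℝ] ℝ where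
  toFun y := v ⬝ᵥ y.ofLp
  map_add' y z := by simp [dotProduct_add]
  map_smul' r y := by simp [dotProduct_smul]

theorem dotForm_apply {k : ℕ} (v : Fin k → ℝ) (y : EuclideanSpace ℝ (Fin k)) :
    dotForm v y = v ⬝ᵥ y.ofLp := rfl

theorem exists_abs_dotForm_sub_le {k : ℕ} (v : Fin k → ℝ) :
    ∃ C : NNReal, ∀ x x', |dotForm v x - dotForm v x'| ≤ C * ‖x - x'‖ :=
  ⟨‖(dotForm v).toContinuousLinearMap‖₊, fun x x' => by
    rw [← map_sub]
    exact (dotForm v).toContinuousLinearMap.le_opNorm (x - x')⟩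

/-! ### The follower's problem as a parametric polytope -/

section Rows

variable {n m p : ℕ} (A : Matrix (Fin p) (Fin n) ℝ) (B : Matrix (Fin p) (Fin m) ℝ)
  (b : Fin p → ℝ) (c : Fin m → ℝ)

/-- The rows of `B` together with the coordinate forms and their negatives. -/
noncomputable def boxedRows : Fin p ⊕ (Fin m ⊕ Fin m) → EuclideanSpace ℝ (Fin m) →ₗ[ℝ] ℝ :=
  Sum.elim (fun i => dotForm (B i))
    (Sum.elim (fun j => dotForm (Pi.single j 1)) fun j => -dotForm (Pi.single j 1))

/-- The right-hand side `b - A x` completed by the bound `R` on the coordinates. -/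
noncomputable def boxedRhs (R : ℝ) (x : EuclideanSpace ℝ (Fin n)) :
    Fin p ⊕ (Fin m ⊕ Fin m) → ℝ :=
  Sum.elim (b - A.mulVec x.ofLp) fun _ => R

theorem isBounded_of_coordinate_le {s : Set (EuclideanSpace ℝ (Fin m))} (u w : Fin m → ℝ)
    (h : ∀ y ∈ s, ∀ j, y j ≤ u j ∧ -y j ≤ w j) : Bornology.IsBounded s :=
  ((EuclideanSpace.equiv (Fin m) ℝ).toHomeomorph.isCompact_preimage.2
    (isCompact_Icc (a := -w) (b := u))).isBounded.subset fun y hy =>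
      ⟨fun j => neg_le.1 (h y hy j).2, fun j => (h y hy j).1⟩

/-- The coordinate rows give boundedness for every right-hand side, as the induction requires,
without recession cones. -/
theorem isBounded_polytope_boxedRows (β : Fin p ⊕ (Fin m ⊕ Fin m) → ℝ) :
    Bornology.IsBounded (polytope (boxedRows B) ⊤ β) :=
  isBounded_of_coordinate_le (fun j => β (.inr (.inl j))) (fun j => β (.inr (.inr j)))
    fun y hy j => ⟨by simpa [boxedRows, dotForm_apply] using hy.2 (.inr (.inl j)),
      by simpa [boxedRows, dotForm_apply] using hy.2 (.inr (.inr j))⟩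

variable {A b} in
theorem polytope_boxedRows_eq {R : ℝ} (hR : ∀ z ∈ jointFeasible A B b, ‖z‖ ≤ R)
    (x : EuclideanSpace ℝ (Fin n)) :
    polytope (boxedRows B) ⊤ (boxedRhs A b R x) = {y | (x, y) ∈ jointFeasible A B b} := by
  ext y
  have hiff : (x, y) ∈ jointFeasible A B b ↔ ∀ i, dotForm (B i) y ≤ (b - A.mulVec x.ofLp) i := by
    simp only [jointFeasible, mem_ofPred_eq, Pi.le_def, Pi.add_apply, Pi.sub_apply, le_sub_iff_add_le']
    rfl
  constructor
  · exact fun hy => hiff.2 fun i => hy.2 (.inl i)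
  · intro hy
    have hb : ∀ j, |y j| ≤ R := fun j =>
      (PiLp.norm_apply_le y j).trans ((norm_snd_le (x, y)).trans (hR _ hy))
    refine ⟨Submodule.mem_top, ?_⟩
    rintro (i | j | j)
    · exact hiff.1 hy i
    · simpa [boxedRows, boxedRhs, dotForm_apply] using (le_abs_self _).trans (hb j)
    · simpa [boxedRows, boxedRhs, dotForm_apply] using (neg_le_abs _).trans (hb j)

theorem exists_norm_boxedRhs_sub_le (R : ℝ) : ∃ C : NNReal, ∀ x x',
    ‖(boxedRhs A b R x - boxedRhs A b R x' : Fin p ⊕ (Fin m ⊕ Fin m) → ℝ)‖ ≤ C * ‖x - x'‖ := by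
  choose D hD using fun i => exists_abs_dotForm_sub_le (A i)
  refine ⟨∑ i, D i, fun x x' => (pi_norm_le_iff_of_nonneg (by positivity)).2 ?_⟩
  rintro (i | j)
  · have h1 : boxedRhs (m := m) A b R x (.inl i) - boxedRhs (m := m) A b R x' (.inl i) =
        dotForm (A i) x' - dotForm (A i) x := by
      simp only [boxedRhs, Sum.elim_inl, Pi.sub_apply, dotForm_apply, Matrix.mulVec]
      ring
    rw [Pi.sub_apply, h1, Real.norm_eq_abs, abs_sub_comm]
    refine (hD i x x').trans (mul_le_mul_of_nonneg_right ?_ (norm_nonneg _))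
    exact_mod_cast Finset.single_le_sum (f := D) (fun _ _ => zero_le) (Finset.mem_univ i)
  · simp only [boxedRhs, Pi.sub_apply, Sum.elim_inr, sub_self, norm_zero]
    positivity

/-- The rows of `boxedRows` together with the follower's objective. -/
noncomputable def argminRows : Option (Fin p ⊕ (Fin m ⊕ Fin m)) → EuclideanSpace ℝ (Fin m) →ₗ[ℝ] ℝ :=
  fun o => o.elim (dotForm c) (boxedRows B)

/-- The follower's optimal value on the box of radius `R`. -/
noncomputable def followerValue (R : ℝ) (x : EuclideanSpace ℝ (Fin n)) : ℝ :=
  sInf (dotForm c '' polytope (boxedRows B) ⊤ (boxedRhs A b R x))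

/-- The right-hand side of the system that describes the follower's solution set. -/
noncomputable def argminRhs (R : ℝ) (x : EuclideanSpace ℝ (Fin n)) :
    Option (Fin p ⊕ (Fin m ⊕ Fin m)) → ℝ :=
  fun o => o.elim (followerValue A B b c R x) (boxedRhs A b R x)

theorem isBounded_polytope_argminRows (β : Option (Fin p ⊕ (Fin m ⊕ Fin m)) → ℝ) :
    Bornology.IsBounded (polytope (argminRows B c) ⊤ β) :=
  (isBounded_polytope_boxedRows B fun i => β (some i)).subset
    fun _ hy => ⟨hy.1, fun i => hy.2 (some i)⟩

variable {A b}

theorem nonempty_polytope_boxedRows {R : ℝ} (hR : ∀ z ∈ jointFeasible A B b, ‖z‖ ≤ R)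
    {x : EuclideanSpace ℝ (Fin n)} (hx : x ∈ leaderFeasible A B b) :
    (polytope (boxedRows B) ⊤ (boxedRhs A b R x)).Nonempty := by
  rw [polytope_boxedRows_eq B hR]
  exact hx

/-- The box is redundant by the choice of `R`, and the optimal value is attained by compactness, so
the extra row selects exactly the minimizers. -/
theorem polytope_argminRows_eq {R : ℝ} (hR : ∀ z ∈ jointFeasible A B b, ‖z‖ ≤ R)
    {x : EuclideanSpace ℝ (Fin n)} (hx : x ∈ leaderFeasible A B b) :
    polytope (argminRows B c) ⊤ (argminRhs A B b c R x) = followerArgmin A B b c x := by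
  have hP := polytope_boxedRows_eq B hR x
  obtain ⟨⟨y₀, hy₀, hy₀v⟩, hmin⟩ := isLeast_sInf_image
    (isCompact_polytope (boxedRows B) ⊤ (isBounded_polytope_boxedRows B) (boxedRhs A b R x))
    (nonempty_polytope_boxedRows B hR hx) (dotForm c)
  ext y
  have h1 : y ∈ polytope (argminRows B c) ⊤ (argminRhs A B b c R x) ↔
      y ∈ polytope (boxedRows B) ⊤ (boxedRhs A b R x) ∧ dotForm c y ≤ followerValue A B b c R x := by
    constructor
    · exact fun hy => ⟨⟨hy.1, fun i => hy.2 (some i)⟩, hy.2 none⟩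
    · refine fun hy => ⟨hy.1.1, ?_⟩
      rintro (_ | i)
      · exact hy.2
      · exact hy.1.2 i
  rw [h1, hP]
  constructor
  · exact fun hy => ⟨hy.1, fun z hz => hy.2.trans (hmin ⟨z, hP ▸ hz, rfl⟩)⟩
  · refine fun hy => ⟨hy.1, ?_⟩
    have h2 : y₀ ∈ {y | (x, y) ∈ jointFeasible A B b} := hP ▸ hy₀
    exact (hy.2 y₀ h2).trans hy₀v.le

theorem nonempty_followerArgmin {R : ℝ} (hR : ∀ z ∈ jointFeasible A B b, ‖z‖ ≤ R)
    {x : EuclideanSpace ℝ (Fin n)} (hx : x ∈ leaderFeasible A B b) :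
    (followerArgmin A B b c x).Nonempty := by
  have hP := polytope_boxedRows_eq B hR x
  obtain ⟨⟨y₀, hy₀, hy₀v⟩, hmin⟩ := isLeast_sInf_image
    (isCompact_polytope (boxedRows B) ⊤ (isBounded_polytope_boxedRows B) (boxedRhs A b R x))
    (nonempty_polytope_boxedRows B hR hx) (dotForm c)
  have h2 : y₀ ∈ {y | (x, y) ∈ jointFeasible A B b} := hP ▸ hy₀
  exact ⟨y₀, h2, fun z hz => hy₀v.le.trans (hmin ⟨z, hP ▸ hz, rfl⟩)⟩

theorem exists_abs_followerValue_sub_le {R : ℝ} (hR : ∀ z ∈ jointFeasible A B b, ‖z‖ ≤ R) :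
    ∃ C : NNReal, ∀ x ∈ leaderFeasible A B b, ∀ x' ∈ leaderFeasible A B b,
      |followerValue A B b c R x - followerValue A B b c R x'| ≤ C * ‖x - x'‖ := by
  -- The minimum of `c` is translation covariant and satisfies the cutting estimate with constant
  -- `1`.
  obtain ⟨L, hL⟩ := exists_lipschitz_polytope (boxedRows B) ⊤ (isBounded_polytope_boxedRows B)
    (fun K => sInf (dotForm c '' K)) (dotForm c) 1
    (fun z K hK _ hne => sInf_image_vadd hK hne _ z)
    (fun K hK hc l b T hb hT hTb L h => by
      simpa using abs_sInf_image_sub_le hK hc (dotForm c) l hb hT hTb h)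
  obtain ⟨D, hD⟩ := exists_norm_boxedRhs_sub_le (m := m) A b R
  refine ⟨L * D, fun x hx x' hx' => (hL _ _ (nonempty_polytope_boxedRows B hR hx)
    (nonempty_polytope_boxedRows B hR hx')).trans ?_⟩
  push_cast
  rw [mul_assoc]
  exact mul_le_mul_of_nonneg_left (hD x x') L.2

theorem exists_norm_argminRhs_sub_le {R : ℝ} (hR : ∀ z ∈ jointFeasible A B b, ‖z‖ ≤ R) :
    ∃ C : NNReal, ∀ x ∈ leaderFeasible A B b, ∀ x' ∈ leaderFeasible A B b,
      ‖argminRhs A B b c R x - argminRhs A B b c R x'‖ ≤ C * ‖x - x'‖ := by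
  obtain ⟨D, hD⟩ := exists_norm_boxedRhs_sub_le (m := m) A b R
  obtain ⟨C, hC⟩ := exists_abs_followerValue_sub_le B c hR
  refine ⟨C + D, fun x hx x' hx' => (pi_norm_le_iff_of_nonneg (by positivity)).2 ?_⟩
  have h0 : 0 ≤ ‖x - x'‖ := norm_nonneg _
  have hC0 : 0 ≤ C * ‖x - x'‖ := by positivity
  have hD0 : 0 ≤ D * ‖x - x'‖ := by positivity
  push_cast
  rw [add_mul]
  rintro (_ | i)
  · exact (hC x hx x' hx').trans (le_add_of_nonneg_right hD0)
  · exact ((norm_le_pi_norm _ i).trans (hD x x')).trans (le_add_of_nonneg_left hC0)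

theorem exists_abs_mean_sub_le {R : ℝ} (hR : ∀ z ∈ jointFeasible A B b, ‖z‖ ≤ R)
    (h : Fin m → ℝ) :
    ∃ C : NNReal, ∀ x ∈ leaderFeasible A B b, ∀ x' ∈ leaderFeasible A B b,
      |∫ y, h ⬝ᵥ y.ofLp ∂(neutralBelief (followerArgmin A B b c) x) -
        ∫ y, h ⬝ᵥ y.ofLp ∂(neutralBelief (followerArgmin A B b c) x')| ≤ C * ‖x - x'‖ := by
  obtain ⟨L, hL⟩ := exists_lipschitz_polytope (argminRows B c) ⊤ (isBounded_polytope_argminRows B c)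
    (fun K => ∫ y, dotForm h y ∂(uniformLaw K)) (dotForm h) (m + 1)
    (fun z K hK hc hne => mean_vadd hK hc hne _ z)
    (fun K hK hc l b T hb hT hTb L hs => by
      simpa using abs_mean_sub_mean_inter_halfSpace_le
        (dotForm h).continuous_of_finiteDimensional hK hc l hb hT hTb hs)
  obtain ⟨D, hD⟩ := exists_norm_argminRhs_sub_le B c hR
  refine ⟨L * D, fun x hx x' hx' => ?_⟩
  have h1 := hL (argminRhs A B b c R x) (argminRhs A B b c R x')
  rw [polytope_argminRows_eq B c hR hx, polytope_argminRows_eq B c hR hx'] at h1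
  refine (h1 (nonempty_followerArgmin B c hR hx) (nonempty_followerArgmin B c hR hx')).trans ?_
  push_cast
  rw [mul_assoc]
  exact mul_le_mul_of_nonneg_left (hD x hx x' hx') L.2

end Rows

end LinearBilevel

theorem mainTheorem6 {n m p : ℕ} (A : Matrix (Fin p) (Fin n) ℝ) (B : Matrix (Fin p) (Fin m) ℝ)
    (b : Fin p → ℝ) (c : Fin m → ℝ) (g : Fin n → ℝ) (h : Fin m → ℝ)
    (hne : (LinearBilevel.jointFeasible A B b).Nonempty)
    (hbdd : Bornology.IsBounded (LinearBilevel.jointFeasible A B b)) :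
    (∀ x ∈ LinearBilevel.leaderFeasible A B b,
      MeasureTheory.IsProbabilityMeasure
        (LinearBilevel.neutralBelief (LinearBilevel.followerArgmin A B b c) x) ∧
      LinearBilevel.neutralBelief (LinearBilevel.followerArgmin A B b c) x
        (LinearBilevel.followerArgmin A B b c x) = 1 ∧
      MeasureTheory.Integrable (fun y : EuclideanSpace ℝ (Fin m) => dotProduct h y.ofLp)
        (LinearBilevel.neutralBelief (LinearBilevel.followerArgmin A B b c) x)) ∧
    ∃ L : NNReal, LipschitzOnWith L
      (LinearBilevel.leaderObjective g h
        (LinearBilevel.neutralBelief (LinearBilevel.followerArgmin A B b c)))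
      (LinearBilevel.leaderFeasible A B b) := by
  obtain ⟨R, hR⟩ := hbdd.exists_norm_le
  constructor
  · intro x hx
    have hS := LinearBilevel.polytope_argminRows_eq B c hR hx
    have hK : IsCompact (LinearBilevel.followerArgmin A B b c x) := hS ▸
      LinearBilevel.isCompact_polytope _ _ (LinearBilevel.isBounded_polytope_argminRows B c) _
    have hc : Convex ℝ (LinearBilevel.followerArgmin A B b c x) := hS ▸
      LinearBilevel.convex_polytope _ _ _
    have hn := LinearBilevel.nonempty_followerArgmin B c hR hx
    exact ⟨LinearBilevel.isProbabilityMeasure_uniformLaw hK hc hn,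
      LinearBilevel.uniformLaw_self hK hc hn, LinearBilevel.integrable_uniformLaw hK hc hn
        (LinearBilevel.dotForm h).continuous_of_finiteDimensional⟩
  · obtain ⟨C, hC⟩ := LinearBilevel.exists_abs_mean_sub_le B c hR h
    obtain ⟨D, hD⟩ := LinearBilevel.exists_abs_dotForm_sub_le g
    refine ⟨D + C, LipschitzOnWith.of_dist_le_mul fun x hx x' hx' => ?_⟩
    rw [Real.dist_eq, dist_eq_norm, LinearBilevel.leaderObjective, LinearBilevel.leaderObjective,
      add_sub_add_comm]
    push_cast
    rw [add_mul]
    exact (abs_add_le _ _).trans (add_le_add (hD x x') (hC x hx x' hx'))
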